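/- Let $A\in\mathbb R^{n\times n}$ and $C\in\mathbb R^{m\times m}$ be row-stochastic matrices, let $\lambda^1,\dots,\lambda^n\in[0,1]$, $\Lambda=\operatorname{diag}(\lambda^1,\dots,\lambda^n)$, and let $$P=\begin{pmatrix}(\Lambda A)\otimes C & (I_n-\Lambda)\otimes I_m\\ 0& I_{nm}\end{pmatrix}$$ be the ($2nm\times 2nm$, row-stochastic) matrix of the belief system $x_{k+1}=Px_k$. Let $\mathcal P$ be the directed graph on the $2nm$ indices with an edge from $\ell$ to $r$ if and only if $P_{r\ell}>0$. A strongly connected component of $\mathcal P$ is called closed if no edge enters it from a node outside of it, and aperiodic if the greatest common divisor of the lengths of the cycles inside it is $1$. A random walk started at a node $i$ is the Markov chain with transition matrix $P$ and $X_0=i$. Suppose that all closed strongly connected components of $\mathcal P$ are aperiodic. Let $$L=\max_{S}\max_{u,v\in S}\mathbb E\bigl[\min\{k\ge 0: X_k=Y_k\}\bigr],$$ where $S$ ranges over the closed strongly connected components and $X,Y$ are independent random walks with $X_0=u$, $Y_0=v$, and let $$H=\max_{i}\ \mathbb E\bigl[\min\{k\ge 0: X_k \text{ lies in a closed strongly connected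 component}\}\bigr],$$ where $i$ ranges over all nodes and $X$ is the random walk with $X_0=i$. For vectors $\mu,\nu$ indexed by the nodes write $\|\mu-\nu\|_{TV}=\sup_{B}|\mu(B)-\nu(B)|$, the supremum being over all sets $B$ of nodes, where $\mu(B)=\sum_{i\in B}\mu_i$. Then $L$ and $H$ are finite, and the following hold. 1. For every probability vector $v$ on the nodes (in particular for the point mass at any node), the distributions $v'P^k$ of the random walk converge as $k\to\infty$ to a limit $v_\infty'$, and $\|v'P^k-v_\infty'\|_{TV}\le\varepsilon$ for all $0<\varepsilon\le\tfrac12$ and all integers $k\ge 4(L+H)\log(1/\varepsilon)$. 2. For every $x_0\in[0,1]^{2nm}$, the beliefs $x_k=P^kx_0$ converge to a limit $x_\infty$, and every node is within $\varepsilon$ of its limiting value, $|x_k^i-x_\infty^i|\le\varepsilon$ for all $i$, for all $0<\varepsilon\le\tfrac12$ and all integers $k\ge 4(L+H)\log(1/\varepsilon)$. -/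

import Mathlib

open scoped Matrix Kronecker ENNReal
open MeasureTheory ProbabilityTheory Filter Topology

namespace BeliefSystem

/-! ### Directed graphs -/

section Graph

variable {V : Type*}

/-- The directed graph of a square matrix `P`, with an edge from `l` to `r` exactly when
`P r l > 0`; a random walk with transition matrix `P` traverses the edges backwards. -/
def matrixGraph (P : Matrix V V ℝ) : Digraph V where
  Adj l r := 0 < P r l

/-- There is a directed path (possibly of length zero) from `i` to `j`. -/
def HasPath (G : Digraph V) (i j : V) : Prop :=
  Relation.ReflTransGen G.Adj i j

/-- `S` is a strongly connected component of `G`: a class of mutual reachability. -/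
def IsStrongComponent (G : Digraph V) (S : Set V) : Prop :=
  ∃ i, S = {j | HasPath G i j ∧ HasPath G j i}

/-- `S` is a strongly connected component of `G` without incoming edges from other nodes. -/
def IsClosedComponent (G : Digraph V) (S : Set V) : Prop :=
  IsStrongComponent G S ∧ ∀ l, l ∉ S → ∀ r ∈ S, ¬ G.Adj l r

/-- The lengths of the cycles (closed paths) of the subgraph of `G` induced by `S`. -/
def cycleLengths (G : Digraph V) (S : Set V) : Set ℕ :=
  {l | ∃ p : Fin (l + 1) → V, (∀ t, p t ∈ S) ∧
    (∀ t : Fin l, G.Adj (p t.castSucc) (p t.succ)) ∧ p 0 = p (Fin.last l)}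

/-- The period of the subgraph induced by `S`, that is, the greatest common divisor of the lengths
of its cycles, equals one. -/
def IsAperiodic (G : Digraph V) (S : Set V) : Prop :=
  ∀ d : ℕ, (∀ l ∈ cycleLengths G S, d ∣ l) → d = 1

end Graph

/-! ### Random walks -/

section Walk

variable {V : Type*} [Fintype V] [DecidableEq V]

/-- The row `P i ·` of a row-stochastic matrix as a probability mass function. -/
noncomputable def rowPMF (P : Matrix V V ℝ) (hP : P ∈ Matrix.rowStochastic ℝ V) (i : V) : PMF V :=
  PMF.ofFintype (fun j => ENNReal.ofReal (P i j)) (by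
    rw [← ENNReal.ofReal_sum_of_nonneg
      (fun j _ => Matrix.nonneg_of_mem_rowStochastic hP),
      Matrix.sum_row_of_mem_rowStochastic hP, ENNReal.ofReal_one])

variable [MeasurableSpace V] [MeasurableSingletonClass V]

/-- The one-step transition kernel `i ↦ P i ·`. -/
noncomputable def stepKernel (P : Matrix V V ℝ) (hP : P ∈ Matrix.rowStochastic ℝ V) :
    Kernel V V :=
  Kernel.ofFunOfCountable fun i => (rowPMF P hP i).toMeasure

instance (P : Matrix V V ℝ) (hP : P ∈ Matrix.rowStochastic ℝ V) :
    IsMarkovKernel (stepKernel P hP) :=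
  ⟨fun i => PMF.toMeasure.isProbabilityMeasure (rowPMF P hP i)⟩

/-- The transition kernel from the history `(X 0, …, X t)` to `X (t + 1)`: it only looks
at the current state `X t`. -/
noncomputable def historyKernel (P : Matrix V V ℝ) (hP : P ∈ Matrix.rowStochastic ℝ V) (t : ℕ) :
    Kernel (Π _ : Finset.Iic t, V) V :=
  (stepKernel P hP).comap (fun h => h ⟨t, Finset.mem_Iic.2 le_rfl⟩) (measurable_pi_apply _)

instance (P : Matrix V V ℝ) (hP : P ∈ Matrix.rowStochastic ℝ V) (t : ℕ) :
    IsMarkovKernel (historyKernel P hP t) := by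
  unfold historyKernel; infer_instance

/-- The law, on the space of trajectories `ℕ → V`, of the random walk (Markov chain) with
transition matrix `P` started at the node `i`. -/
noncomputable def walkLaw (P : Matrix V V ℝ) (hP : P ∈ Matrix.rowStochastic ℝ V) (i : V) :
    Measure (ℕ → V) :=
  Kernel.trajMeasure (X := fun _ => V) (Measure.dirac i) (historyKernel P hP)

instance (P : Matrix V V ℝ) (hP : P ∈ Matrix.rowStochastic ℝ V) (i : V) :
    IsProbabilityMeasure (walkLaw P hP i) := by
  unfold walkLaw; infer_instance

/-- The first time `k ≥ 0` at which two trajectories agree (`∞` if they never do). -/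
noncomputable def couplingTime (X Y : ℕ → V) : ℝ≥0∞ :=
  ⨅ (k : ℕ) (_ : X k = Y k), (k : ℝ≥0∞)

/-- The first time `k ≥ 0` at which a trajectory is in a closed strongly connected component of `G`
(`∞` if it never is). -/
noncomputable def absorptionTime (G : Digraph V) (X : ℕ → V) : ℝ≥0∞ :=
  ⨅ (k : ℕ) (_ : ∃ S, IsClosedComponent G S ∧ X k ∈ S), (k : ℝ≥0∞)

/-- `L`: the maximum, over the closed strongly connected components `S` of the graph of `P` and over
`u, v ∈ S`, of the expected coupling time of two independent random walks started at `u`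
and `v`. -/
noncomputable def maxCouplingTime (P : Matrix V V ℝ) (hP : P ∈ Matrix.rowStochastic ℝ V) : ℝ≥0∞ :=
  ⨆ (S : Set V) (_ : IsClosedComponent (matrixGraph P) S) (u ∈ S) (v ∈ S),
    ∫⁻ ω, couplingTime ω.1 ω.2 ∂((walkLaw P hP u).prod (walkLaw P hP v))

/-- `H`: the maximum, over all starting nodes, of the expected time at which the random walk gets
absorbed into a closed strongly connected component of the graph of `P`. -/
noncomputable def maxAbsorptionTime (P : Matrix V V ℝ) (hP : P ∈ Matrix.rowStochastic ℝ V) :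
    ℝ≥0∞ :=
  ⨆ i : V, ∫⁻ X, absorptionTime (matrixGraph P) X ∂(walkLaw P hP i)

end Walk

/-- Total variation distance of two distributions on a finite set: the supremum over all events `B`
of `|μ B - ν B|`. -/
noncomputable def tvDist {V : Type*} (μ ν : V → ℝ) : ℝ :=
  ⨆ B : Finset V, |∑ i ∈ B, μ i - ∑ i ∈ B, ν i|

/-! ### The belief system -/

section System

variable {n m : ℕ}

/-- The nodes of the belief system of `n` agents and `m` statements: `Sum.inl (i, u)` is the current
belief of agent `i` on statement `u`, and `Sum.inr (i, u)` its initial belief. -/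
abbrev Node (n m : ℕ) : Type := (Fin n × Fin m) ⊕ (Fin n × Fin m)

instance : MeasurableSingletonClass (Node n m) where
  measurableSet_singleton x := by
    rcases x with x | x
    · rw [← Set.image_singleton]
      exact MeasurableSet.inl_image (measurableSet_singleton x)
    · rw [← Set.image_singleton]
      exact MeasurableSet.inr_image (measurableSet_singleton x)

/-- The system matrix with block rows `(Λ A) ⊗ C`, `(I - Λ) ⊗ I` and `0`, `I`,
where `Λ` is the diagonal matrix with diagonal `lam`. -/
noncomputable def systemMatrix (A : Matrix (Fin n) (Fin n) ℝ) (C : Matrix (Fin m) (Fin m) ℝ)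
    (lam : Fin n → ℝ) : Matrix (Node n m) (Node n m) ℝ :=
  Matrix.fromBlocks ((Matrix.diagonal lam * A) ⊗ₖ C)
    ((1 - Matrix.diagonal lam) ⊗ₖ (1 : Matrix (Fin m) (Fin m) ℝ)) 0 1

theorem systemMatrix_mem {A : Matrix (Fin n) (Fin n) ℝ} {C : Matrix (Fin m) (Fin m) ℝ}
    {lam : Fin n → ℝ} (hA : A ∈ Matrix.rowStochastic ℝ (Fin n))
    (hC : C ∈ Matrix.rowStochastic ℝ (Fin m)) (hlam : ∀ i, lam i ∈ Set.Icc (0 : ℝ) 1) :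
    systemMatrix A C lam ∈ Matrix.rowStochastic ℝ (Node n m) := by
  rw [Matrix.mem_rowStochastic_iff_sum] at hA hC ⊢
  have h0 : ∀ i j : Fin n, 0 ≤ ((1 : Matrix (Fin n) (Fin n) ℝ) - Matrix.diagonal lam) i j := by
    intro i j
    by_cases h : i = j
    · subst h; simpa using (hlam i).2
    · simp [h]
  have hone : ∀ (k : ℕ) (i j : Fin k), (0 : ℝ) ≤ (1 : Matrix (Fin k) (Fin k) ℝ) i j := by
    intro k i j; rw [Matrix.one_apply]; split_ifs <;> norm_num
  constructor
  · rintro (⟨i, u⟩ | ⟨i, u⟩) (⟨j, v⟩ | ⟨j, v⟩)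
    · simp only [systemMatrix, Matrix.fromBlocks_apply₁₁, Matrix.kronecker_apply,
        Matrix.diagonal_mul]
      exact mul_nonneg (mul_nonneg (hlam i).1 (hA.1 i j)) (hC.1 u v)
    · simp only [systemMatrix, Matrix.fromBlocks_apply₁₂, Matrix.kronecker_apply]
      exact mul_nonneg (h0 i j) (hone m u v)
    · simp [systemMatrix]
    · simp only [systemMatrix, Matrix.fromBlocks_apply₂₂, Matrix.one_apply]
      split_ifs <;> norm_num
  · rintro (⟨i, u⟩ | ⟨i, u⟩)
    · simp only [systemMatrix, Fintype.sum_sum_type, Matrix.fromBlocks_apply₁₁,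
        Matrix.fromBlocks_apply₁₂, Matrix.kronecker_apply, Matrix.diagonal_mul,
        Fintype.sum_prod_type, ← Finset.mul_sum, hC.2, hA.2, mul_one, Matrix.one_apply]
      simp [Matrix.one_apply, Matrix.diagonal_apply]
    · simp [systemMatrix, Matrix.one_apply]

end System

end BeliefSystem

open BeliefSystem

/-!
Follow a walk until it enters a closed component and then until it meets an independent walk started
in that component: the expected number of steps is at most `B = L + H` from any start. Cut `k` steps
into `m = ⌈log (1 / ε)⌉` blocks of equal length. By Markov's inequality each block is survived with
probability at most `y = m / (4 log (1 / ε))` as soon as `4 B log (1 / ε) ≤ k`, and restarting the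
walks after every block bounds the probability of not having met after `k` steps by `y ^ m ≤ ε`.

To compare the distributions at times `k` and `k + n`, couple a walk with a copy of it that is `n`
steps ahead: once the walk is at a recurrent node `u`, the copy starts from a random position that
the walk would occupy `n` steps after `u`, which is in the component of `u`, and moves
independently. Both distributions thus differ by at most the probability that these walks have not
met, uniformly in `n`; so the sequence is Cauchy and the limit inherits the bound.
-/

open scoped NNReal

namespace BeliefSystem

section Stochastic

variable {V W : Type*} [Fintype V] [Fintype W]

theorem kronecker_mulVec_apply (P : Matrix V V ℝ) (Q : Matrix W W ℝ) (f : V × W → ℝ)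
    (p : V × W) : ((P ⊗ₖ Q) *ᵥ f) p = (P *ᵥ fun i => (Q *ᵥ fun j => f (i, j)) p.2) p.1 := by
  simp only [Matrix.mulVec, dotProduct, Matrix.kroneckerMap_apply, Fintype.sum_prod_type,
    Finset.mul_sum, mul_assoc]

/-- A set of states is absorbing if the chain with transition matrix `Q` cannot leave it. -/
def IsAbsorbing (Q : Matrix W W ℝ) (I : Set W) : Prop :=
  ∀ ⦃x⦄, x ∈ I → ∀ ⦃y⦄, Q x y ≠ 0 → y ∈ I

variable {Q : Matrix W W ℝ} {I : Set W} {f g : W → ℝ}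

theorem IsAbsorbing.mulVec_eqOn (hI : IsAbsorbing Q I) (h : Set.EqOn f g I) :
    Set.EqOn (Q *ᵥ f) (Q *ᵥ g) I := by
  refine fun x hx => Finset.sum_congr rfl fun y _ => ?_
  by_cases hxy : Q x y = 0
  · simp only [hxy, zero_mul]
  · rw [h (hI hx hxy)]

variable [DecidableEq V] [DecidableEq W]

theorem kronecker_mem_rowStochastic {P : Matrix V V ℝ} {Q : Matrix W W ℝ}
    (hP : P ∈ Matrix.rowStochastic ℝ V) (hQ : Q ∈ Matrix.rowStochastic ℝ W) :
    P ⊗ₖ Q ∈ Matrix.rowStochastic ℝ (V × W) := by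
  rw [Matrix.mem_rowStochastic_iff_sum] at hP hQ ⊢
  refine ⟨fun x y => mul_nonneg (hP.1 _ _) (hQ.1 _ _), fun x => ?_⟩
  simp [Fintype.sum_prod_type, ← Finset.mul_sum, hQ.2, hP.2]

theorem kronecker_pow (P : Matrix V V ℝ) (Q : Matrix W W ℝ) (k : ℕ) :
    (P ⊗ₖ Q) ^ k = (P ^ k) ⊗ₖ (Q ^ k) := by
  induction k with
  | zero => simp
  | succ k ih => rw [pow_succ, pow_succ, pow_succ, ih, Matrix.mul_kronecker_mul]

theorem mulVec_const {Q : Matrix V V ℝ} (hQ : Q ∈ Matrix.rowStochastic ℝ V) (c : ℝ) :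
    (Q *ᵥ fun _ => c) = fun _ => c := by
  ext i
  rw [Matrix.mulVec, dotProduct, ← Finset.sum_mul, Matrix.sum_row_of_mem_rowStochastic hQ, one_mul]

theorem IsAbsorbing.mulVec_le_mulVec (hQ : Q ∈ Matrix.rowStochastic ℝ W) (hI : IsAbsorbing Q I)
    (h : ∀ x ∈ I, f x ≤ g x) {x : W} (hx : x ∈ I) : (Q *ᵥ f) x ≤ (Q *ᵥ g) x := by
  refine Finset.sum_le_sum fun y _ => ?_
  by_cases hxy : Q x y = 0
  · simp only [hxy, zero_mul, le_refl]
  · exact mul_le_mul_of_nonneg_left (h y (hI hx hxy)) (Matrix.nonneg_of_mem_rowStochastic hQ)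

theorem mulVec_mono (hQ : Q ∈ Matrix.rowStochastic ℝ W) : Monotone (Q *ᵥ ·) :=
  fun _ _ h _ => Finset.sum_le_sum fun y _ =>
    mul_le_mul_of_nonneg_left (h y) (Matrix.nonneg_of_mem_rowStochastic hQ)

theorem mulVec_mem_Icc (hQ : Q ∈ Matrix.rowStochastic ℝ W) (hf : f ∈ Set.Icc 0 1) :
    Q *ᵥ f ∈ Set.Icc 0 1 :=
  ⟨by simpa only [Matrix.mulVec_zero] using mulVec_mono hQ hf.1,
    by simpa only [Matrix.one_vecMul_of_mem_rowStochastic hQ] using mulVec_mono hQ hf.2⟩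

end Stochastic

section Survival

variable {W : Type*} [Fintype W]

/-- `survival Q T k x` is the probability that the Markov chain with transition matrix `Q` started
at `x` avoids the set `T` at all the times `0, …, k`, computed by conditioning on the first
step. -/
noncomputable def survival (Q : Matrix W W ℝ) (T : Set W) : ℕ → W → ℝ
  | 0 => Tᶜ.indicator 1
  | k + 1 => Tᶜ.indicator (Q *ᵥ survival Q T k)

variable {Q : Matrix W W ℝ} {T I : Set W}

theorem survival_of_mem {x : W} (hx : x ∈ T) (k : ℕ) : survival Q T k x = 0 := by
  cases k <;> exact Set.indicator_of_notMem (Set.notMem_compl_iff.2 hx) _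

theorem survival_zero {x : W} (hx : x ∉ T) : survival Q T 0 x = 1 :=
  Set.indicator_of_mem hx _

theorem survival_succ {x : W} (hx : x ∉ T) (k : ℕ) :
    survival Q T (k + 1) x = (Q *ᵥ survival Q T k) x :=
  Set.indicator_of_mem hx _

theorem survival_congr {Q' : Matrix W W ℝ} {T' : Set W} (hI : IsAbsorbing Q I)
    (hQ : ∀ x ∈ I, Q x = Q' x) (hT : I ∩ T = I ∩ T') (k : ℕ) :
    Set.EqOn (survival Q T k) (survival Q' T' k) I := by
  have hmem {x : W} (hx : x ∈ I) : x ∈ T ↔ x ∈ T' := by simpa [hx] using Set.ext_iff.1 hT x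
  induction k with
  | zero =>
    intro x hx
    by_cases hxT : x ∈ T
    · rw [survival_of_mem hxT, survival_of_mem ((hmem hx).1 hxT)]
    · rw [survival_zero hxT, survival_zero (mt (hmem hx).2 hxT)]
  | succ k ih =>
    intro x hx
    by_cases hxT : x ∈ T
    · rw [survival_of_mem hxT, survival_of_mem ((hmem hx).1 hxT)]
    · rw [survival_succ hxT, survival_succ (mt (hmem hx).2 hxT), hI.mulVec_eqOn ih hx,
        Matrix.mulVec, hQ x hx, Matrix.mulVec]

theorem survival_preimage {V : Type*} [Fintype V] {P : Matrix V V ℝ} {f : W → V}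
    (hf : ∀ g : V → ℝ, Q *ᵥ (g ∘ f) = (P *ᵥ g) ∘ f) (R : Set V) (k : ℕ) :
    survival Q (f ⁻¹' R) k = survival P R k ∘ f := by
  induction k with
  | zero => rfl
  | succ k ih => rw [survival, ih, hf]; rfl

variable [DecidableEq W]

theorem survival_nonneg (hQ : Q ∈ Matrix.rowStochastic ℝ W) (k : ℕ) : 0 ≤ survival Q T k := by
  induction k with
  | zero => exact Set.indicator_nonneg fun _ _ => zero_le_one
  | succ k ih =>
    exact Set.indicator_nonneg fun x _ => Matrix.nonneg_mulVec_of_mem_rowStochastic hQ ih x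

theorem survival_antitone (hQ : Q ∈ Matrix.rowStochastic ℝ W) : Antitone (survival Q T) := by
  refine antitone_nat_of_succ_le fun k => ?_
  induction k with
  | zero =>
    exact Set.indicator_mono
      ((mulVec_mono hQ (Set.indicator_le_self' fun _ _ => zero_le_one)).trans_eq
        (Matrix.one_vecMul_of_mem_rowStochastic hQ))
  | succ k ih => exact Set.indicator_mono (mulVec_mono hQ ih)

theorem survival_le_one (hQ : Q ∈ Matrix.rowStochastic ℝ W) (k : ℕ) : survival Q T k ≤ 1 :=
  (survival_antitone hQ k.zero_le).trans (Set.indicator_le_self' fun _ _ => zero_le_one)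

theorem survival_add_le (hQ : Q ∈ Matrix.rowStochastic ℝ W) (hI : IsAbsorbing Q I) {m : ℕ} {b : ℝ}
    (hb : ∀ x ∈ I, survival Q T m x ≤ b) (k : ℕ) :
    ∀ x ∈ I, survival Q T (k + m) x ≤ b * survival Q T k x := by
  induction k with
  | zero =>
    intro x hx
    by_cases hxT : x ∈ T
    · simp only [survival_of_mem hxT, mul_zero, le_refl]
    · simpa only [survival_zero hxT, zero_add, mul_one] using hb x hx
  | succ k ih =>
    intro x hx
    by_cases hxT : x ∈ T
    · simp only [survival_of_mem hxT, mul_zero, le_refl]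
    · rw [add_right_comm, survival_succ hxT, survival_succ hxT, ← smul_eq_mul, ← Pi.smul_apply,
        ← Matrix.mulVec_smul]
      exact hI.mulVec_le_mulVec hQ ih hx

theorem survival_mul_le_pow (hQ : Q ∈ Matrix.rowStochastic ℝ W) (hI : IsAbsorbing Q I) {m : ℕ}
    {b : ℝ} (hb : ∀ x ∈ I, survival Q T m x ≤ b) (j : ℕ) {x : W} (hx : x ∈ I) :
    survival Q T (j * m) x ≤ b ^ j := by
  have hb0 : 0 ≤ b := (survival_nonneg hQ m x).trans (hb x hx)
  induction j with
  | zero => simpa using survival_le_one hQ 0 x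
  | succ j ih =>
    rw [add_mul, one_mul, pow_succ']
    exact (survival_add_le hQ hI hb (j * m) x hx).trans (mul_le_mul_of_nonneg_left ih hb0)

theorem survival_le_one_sub_pow_apply (hQ : Q ∈ Matrix.rowStochastic ℝ W) {y : W} (hy : y ∈ T)
    (k : ℕ) (x : W) : survival Q T k x ≤ 1 - (Q ^ k) x y := by
  induction k generalizing x with
  | zero =>
    by_cases hx : x ∈ T
    · rw [survival_of_mem hx, sub_nonneg]
      exact Matrix.le_one_of_mem_rowStochastic (pow_mem hQ 0)
    · simp [survival_zero hx, ne_of_mem_of_not_mem hy hx |>.symm]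
  | succ k ih =>
    by_cases hx : x ∈ T
    · rw [survival_of_mem hx, sub_nonneg]
      exact Matrix.le_one_of_mem_rowStochastic (pow_mem hQ (k + 1))
    · calc survival Q T (k + 1) x ≤ (Q *ᵥ (1 - (Q ^ k).col y)) x := by
            rw [survival_succ hx]
            exact mulVec_mono hQ ih x
        _ = 1 - (Q ^ (k + 1)) x y := by
            rw [Matrix.mulVec_sub, Matrix.one_vecMul_of_mem_rowStochastic hQ, pow_succ']
            rfl

theorem abs_le_survival (hQ : Q ∈ Matrix.rowStochastic ℝ W) {g : ℕ → W → ℝ}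
    (h0 : ∀ x, |g 0 x| ≤ 1) (hT : ∀ k, ∀ x ∈ T, g k x = 0) (hg : ∀ k, g (k + 1) = Q *ᵥ g k)
    (k : ℕ) (x : W) : |g k x| ≤ survival Q T k x := by
  induction k generalizing x with
  | zero =>
    by_cases hx : x ∈ T
    · rw [hT 0 x hx, survival_of_mem hx, abs_zero]
    · exact (h0 x).trans_eq (survival_zero hx).symm
  | succ k ih =>
    by_cases hx : x ∈ T
    · rw [hT _ x hx, survival_of_mem hx, abs_zero]
    · rw [hg, survival_succ hx, abs_le, ← Pi.neg_apply (f := Q *ᵥ _), ← Matrix.mulVec_neg]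
      exact ⟨mulVec_mono hQ (fun z => (abs_le.1 (ih z)).1) x,
        mulVec_mono hQ (fun z => (abs_le.1 (ih z)).2) x⟩

end Survival

theorem mul_log_le_neg_log_two_div_two {y : ℝ} (hy : y ∈ Set.Icc (1 / 4 : ℝ) (1 / 2)) :
    y * Real.log y ≤ -(Real.log 2 / 2) := by
  refine (Real.convexOn_mul_log.le_max_of_mem_Icc (by norm_num) (by norm_num) hy).trans_eq ?_
  -- The convex function `y log y` takes the same value at both end points of the interval.
  have hfour : Real.log 4 = 2 * Real.log 2 := by
    rw [← Real.log_rpow two_pos]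
    norm_num
  simp only [one_div, Real.log_inv, hfour]
  ring_nf
  exact max_self _

theorem div_pow_ceil_le_exp_neg {a : ℝ} (ha : 1 / 2 ≤ a) :
    (⌈a⌉₊ / (4 * a)) ^ ⌈a⌉₊ ≤ Real.exp (-a) := by
  have ha0 : 0 < a := one_half_pos.trans_le ha
  set y : ℝ := ⌈a⌉₊ / (4 * a) with hy
  have hceil : (⌈a⌉₊ : ℝ) = 4 * a * y := by rw [hy]; field_simp
  have hy_mem : y ∈ Set.Icc (1 / 4 : ℝ) (1 / 2) := by
    refine ⟨?_, ?_⟩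
    · rw [le_div_iff₀ (by positivity)]
      linarith [Nat.le_ceil a]
    · rw [div_le_iff₀ (by positivity)]
      linarith [Nat.ceil_le_two_mul (by simpa using ha)]
  have hy0 : 0 < y := lt_of_lt_of_le (by norm_num) hy_mem.1
  rw [← Real.log_le_iff_le_exp (pow_pos hy0 _), Real.log_pow]
  calc ⌈a⌉₊ * Real.log y = 4 * a * (y * Real.log y) := by rw [hceil, mul_assoc]
    _ ≤ 4 * a * -(Real.log 2 / 2) := by gcongr; exact mul_log_le_neg_log_two_div_two hy_mem
    _ ≤ -a := by nlinarith [Real.log_two_gt_d9]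

section TruncatedHittingTime

variable {W : Type*} [Fintype W]

/-- The expectation of the minimum of `N` and the hitting time of `T`, for the Markov chain with
transition matrix `Q` started at `x`, written as the sum of its tail probabilities. -/
noncomputable def truncatedHittingTime (Q : Matrix W W ℝ) (T : Set W) (N : ℕ) (x : W) : ℝ :=
  ∑ k ∈ Finset.range N, survival Q T k x

variable {Q : Matrix W W ℝ} {T A I : Set W}

theorem truncatedHittingTime_zero (x : W) : truncatedHittingTime Q T 0 x = 0 :=
  Finset.sum_range_zero _

theorem truncatedHittingTime_of_mem {x : W} (hx : x ∈ T) (N : ℕ) :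
    truncatedHittingTime Q T N x = 0 :=
  Finset.sum_eq_zero fun k _ => survival_of_mem hx k

theorem truncatedHittingTime_succ {x : W} (hx : x ∉ T) (N : ℕ) :
    truncatedHittingTime Q T (N + 1) x = 1 + (Q *ᵥ truncatedHittingTime Q T N) x := by
  simp only [truncatedHittingTime, Finset.sum_range_succ', survival_zero hx, survival_succ hx,
    Matrix.mulVec, dotProduct, Finset.mul_sum]
  rw [Finset.sum_comm, add_comm]

variable [DecidableEq W]

theorem truncatedHittingTime_nonneg (hQ : Q ∈ Matrix.rowStochastic ℝ W) (N : ℕ) (x : W) :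
    0 ≤ truncatedHittingTime Q T N x :=
  Finset.sum_nonneg fun k _ => survival_nonneg hQ k x

/-- The strong Markov property at the hitting time of `A`. -/
theorem truncatedHittingTime_le_add (hQ : Q ∈ Matrix.rowStochastic ℝ W) (hI : IsAbsorbing Q I)
    {L : ℝ} (hL0 : 0 ≤ L) (hL : ∀ N, ∀ x ∈ I ∩ A, truncatedHittingTime Q T N x ≤ L) (N : ℕ) :
    ∀ x ∈ I, truncatedHittingTime Q T N x ≤ L + truncatedHittingTime Q A N x := by
  induction N with
  | zero => exact fun x _ => by simpa only [truncatedHittingTime_zero, add_zero] using hL0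
  | succ N ih =>
    intro x hx
    by_cases hxA : x ∈ A
    · rw [truncatedHittingTime_of_mem hxA, add_zero]
      exact hL _ x ⟨hx, hxA⟩
    by_cases hxT : x ∈ T
    · rw [truncatedHittingTime_of_mem hxT]
      exact add_nonneg hL0 (truncatedHittingTime_nonneg hQ _ x)
    calc truncatedHittingTime Q T (N + 1) x
        = 1 + (Q *ᵥ truncatedHittingTime Q T N) x := truncatedHittingTime_succ hxT N
      _ ≤ 1 + (Q *ᵥ (L • 1 + truncatedHittingTime Q A N)) x := by
          gcongr
          exact hI.mulVec_le_mulVec hQ (by simpa using ih) hx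
      _ = L + truncatedHittingTime Q A (N + 1) x := by
          rw [truncatedHittingTime_succ hxA, Matrix.mulVec_add, Matrix.mulVec_smul,
            Matrix.one_vecMul_of_mem_rowStochastic hQ]
          simp only [Pi.add_apply, Pi.smul_apply, Pi.one_apply, smul_eq_mul, mul_one]
          ring

theorem truncatedHittingTime_le_div (hQ : Q ∈ Matrix.rowStochastic ℝ W) (hI : IsAbsorbing Q I)
    {K : ℕ} {ρ : ℝ} (hρ : ρ < 1) (hK : ∀ x ∈ I, survival Q T K x ≤ ρ) (N : ℕ) {x : W}
    (hx : x ∈ I) : truncatedHittingTime Q T N x ≤ K / (1 - ρ) := by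
  rw [le_div_iff₀ (sub_pos.2 hρ), mul_one_sub, sub_le_iff_le_add]
  calc truncatedHittingTime Q T N x ≤ truncatedHittingTime Q T (K + N) x :=
        Finset.sum_le_sum_of_subset_of_nonneg (Finset.range_mono (Nat.le_add_left N K))
          fun k _ _ => survival_nonneg hQ k x
    _ = ∑ k ∈ Finset.range K, survival Q T k x + ∑ k ∈ Finset.range N, survival Q T (k + K) x := by
        simp only [truncatedHittingTime, Finset.sum_range_add, add_comm _ K]
    _ ≤ ∑ _k ∈ Finset.range K, 1 + ∑ k ∈ Finset.range N, ρ * survival Q T k x :=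
        add_le_add (Finset.sum_le_sum fun k _ => survival_le_one hQ k x)
          (Finset.sum_le_sum fun k _ => survival_add_le hQ hI hK k x hx)
    _ = K + truncatedHittingTime Q T N x * ρ := by
        rw [← Finset.mul_sum, mul_comm ρ]
        simp [truncatedHittingTime]

theorem exists_truncatedHittingTime_le (hQ : Q ∈ Matrix.rowStochastic ℝ W) (hI : IsAbsorbing Q I)
    (h : ∀ x ∈ I, ∃ k, ∃ y ∈ T, 0 < (Q ^ k) x y) :
    ∃ B : ℝ≥0, ∀ N, ∀ x ∈ I, truncatedHittingTime Q T N x ≤ B := by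
  choose! τ y hy hpos using h
  set K := Finset.univ.sup τ
  have hlt (x : W) (hx : x ∈ I) : survival Q T K x < 1 :=
    calc survival Q T K x ≤ survival Q T (τ x) x :=
          survival_antitone hQ (Finset.le_sup (Finset.mem_univ x)) x
      _ ≤ 1 - (Q ^ τ x) x (y x) := survival_le_one_sub_pow_apply hQ (hy x hx) _ x
      _ < 1 := sub_lt_self 1 (hpos x hx)
  obtain ⟨ρ, hKρ, hρ⟩ : ∃ ρ : ℝ, (∀ x ∈ I, ρ ∈ Set.Ioo (survival Q T K x) 1) ∧ ρ < 1 :=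
    ((I.toFinite.eventually_all.2 fun x hx => Ioo_mem_nhdsLT (hlt x hx)).and
      self_mem_nhdsWithin).exists
  exact ⟨⟨K / (1 - ρ), div_nonneg K.cast_nonneg (sub_pos.2 hρ).le⟩, fun N x hx =>
    truncatedHittingTime_le_div hQ hI hρ (fun z hz => (hKρ z hz).1.le) N hx⟩

/-- Markov's inequality for the hitting time of `T`. -/
theorem survival_le_div_of_truncatedHittingTime_le (hQ : Q ∈ Matrix.rowStochastic ℝ W) {B : ℝ}
    {x : W} {t : ℕ} (hB : truncatedHittingTime Q T (t + 1) x ≤ B) :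
    survival Q T t x ≤ B / (t + 1) := by
  rw [le_div_iff₀ (by positivity)]
  calc survival Q T t x * (t + 1) = ∑ _k ∈ Finset.range (t + 1), survival Q T t x := by
        simp [mul_comm]
    _ ≤ truncatedHittingTime Q T (t + 1) x := Finset.sum_le_sum fun k hk =>
        survival_antitone hQ (Finset.mem_range_succ_iff.1 hk) x
    _ ≤ B := hB

theorem survival_le_of_log_le (hQ : Q ∈ Matrix.rowStochastic ℝ W) (hI : IsAbsorbing Q I) {B : ℝ}
    (hB : ∀ N, ∀ x ∈ I, truncatedHittingTime Q T N x ≤ B) {ε : ℝ} (hε0 : 0 < ε) (hε : ε ≤ 1 / 2)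
    {k : ℕ} (hk : 4 * B * Real.log (1 / ε) ≤ k) {x : W} (hx : x ∈ I) : survival Q T k x ≤ ε := by
  set a := Real.log (1 / ε)
  have ha : 1 / 2 ≤ a := by
    have h2 : Real.log 2 ≤ a :=
      Real.log_le_log two_pos ((le_one_div hε0 two_pos).1 hε)
    linarith [Real.log_two_gt_d9]
  have hceil : 0 < ⌈a⌉₊ := Nat.ceil_pos.2 (by linarith)
  set t := k / ⌈a⌉₊
  have hbound : ∀ z ∈ I, survival Q T t z ≤ ⌈a⌉₊ / (4 * a) := by
    intro z hz
    refine (survival_le_div_of_truncatedHittingTime_le hQ (hB _ z hz)).trans ?_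
    rw [div_le_div_iff₀ (by positivity) (by positivity)]
    calc B * (4 * a) = 4 * B * a := by ring
      _ ≤ k := hk
      _ ≤ ⌈a⌉₊ * (t + 1) := mod_cast (Nat.lt_mul_div_succ k hceil).le
  calc survival Q T k x ≤ survival Q T (⌈a⌉₊ * t) x :=
        survival_antitone hQ (Nat.mul_div_le k _) x
    _ ≤ (⌈a⌉₊ / (4 * a)) ^ ⌈a⌉₊ := survival_mul_le_pow hQ hI hbound _ hx
    _ ≤ Real.exp (-a) := div_pow_ceil_le_exp_neg ha
    _ = ε := by rw [← Real.log_inv, inv_div, div_one, Real.exp_log hε0]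

end TruncatedHittingTime

section Reachability

variable {V : Type*}

/-- The union of the closed strongly connected components of the graph of `P`. -/
def recurrentSet (P : Matrix V V ℝ) : Set V :=
  {j | ∃ S, IsClosedComponent (matrixGraph P) S ∧ j ∈ S}

/-- The pairs of nodes that lie in a common closed strongly connected component of the graph of `P`:
the starting points of two walks over which `L` is a maximum. -/
def recurrentPairs (P : Matrix V V ℝ) : Set (V × V) :=
  {p | ∃ S, IsClosedComponent (matrixGraph P) S ∧ p.1 ∈ S ∧ p.2 ∈ S}

theorem exists_isClosedComponent_hasPath [Finite V] (G : Digraph V) (i : V) :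
    ∃ S, IsClosedComponent G S ∧ ∃ j ∈ S, HasPath G j i := by
  obtain ⟨j, hj, hmin⟩ := {j | HasPath G j i}.toFinite.exists_minimalFor
    (fun j => {w | HasPath G w j}.ncard) _ ⟨i, Relation.ReflTransGen.refl⟩
  refine ⟨{k | HasPath G j k ∧ HasPath G k j}, ⟨⟨j, rfl⟩, ?_⟩, j,
    ⟨Relation.ReflTransGen.refl, Relation.ReflTransGen.refl⟩, hj⟩
  rintro l hl r ⟨-, hr⟩ hadj
  have hlj : HasPath G l j := Relation.ReflTransGen.head hadj hr
  have hsub : {w | HasPath G w l} ⊆ {w | HasPath G w j} := fun w hw =>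
    Relation.ReflTransGen.trans hw hlj
  have heq : {w | HasPath G w l} = {w | HasPath G w j} :=
    Set.eq_of_subset_of_ncard_le hsub
      (hmin (Relation.ReflTransGen.trans hlj hj) (Set.ncard_le_ncard hsub)) (Set.toFinite _)
  have hjl : j ∈ {w | HasPath G w l} := heq ▸ (Relation.ReflTransGen.refl : HasPath G j j)
  exact hl ⟨hjl, hlj⟩

theorem IsStrongComponent.hasPath {G : Digraph V} {S : Set V} (hS : IsStrongComponent G S)
    {u v : V} (hu : u ∈ S) (hv : v ∈ S) : HasPath G u v := by
  obtain ⟨i, rfl⟩ := hS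
  exact Relation.ReflTransGen.trans hu.2 hv.1

variable {P : Matrix V V ℝ} {S : Set V}

theorem IsClosedComponent.isAbsorbing (hP : ∀ i j, 0 ≤ P i j)
    (hS : IsClosedComponent (matrixGraph P) S) : IsAbsorbing P S := fun u hu v h =>
  by_contra fun hv => hS.2 v hv u hu ((hP u v).lt_of_ne' h)

theorem fst_mem_recurrentSet {p : V × V} (hp : p ∈ recurrentPairs P) : p.1 ∈ recurrentSet P :=
  let ⟨S, hS, hp₁, _⟩ := hp
  ⟨S, hS, hp₁⟩

theorem isAbsorbing_recurrentSet (hP : ∀ i j, 0 ≤ P i j) : IsAbsorbing P (recurrentSet P) :=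
  fun _ ⟨S, hS, hi⟩ _ hij => ⟨S, hS, hS.isAbsorbing hP hi hij⟩

theorem isAbsorbing_recurrentPairs (hP : ∀ i j, 0 ≤ P i j) :
    IsAbsorbing (P ⊗ₖ P) (recurrentPairs P) := by
  rintro p ⟨S, hS, hp₁, hp₂⟩ q hpq
  exact ⟨S, hS, hS.isAbsorbing hP hp₁ (left_ne_zero_of_mul hpq),
    hS.isAbsorbing hP hp₂ (right_ne_zero_of_mul hpq)⟩

variable [Fintype V] [DecidableEq V]

theorem IsAbsorbing.pow (hS : IsAbsorbing P S) (k : ℕ) : IsAbsorbing (P ^ k) S := by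
  intro u hu v h
  induction k generalizing u with
  | zero => exact not_imp_comm.1 (fun huv => by simp [ne_of_mem_of_not_mem hu huv]) h
  | succ k ih =>
    rw [pow_succ', Matrix.mul_apply] at h
    obtain ⟨z, -, hz⟩ := Finset.exists_ne_zero_of_sum_ne_zero h
    exact ih (hS hu (left_ne_zero_of_mul hz)) (right_ne_zero_of_mul hz)

theorem pow_add_pos (hP : ∀ i j, 0 ≤ P i j) {k l : ℕ} {x y z : V} (hk : 0 < (P ^ k) x y)
    (hl : 0 < (P ^ l) y z) : 0 < (P ^ (k + l)) x z := by
  rw [pow_add, Matrix.mul_apply]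
  exact Finset.sum_pos'
    (fun w _ => mul_nonneg (Matrix.pow_apply_nonneg hP k x w) (Matrix.pow_apply_nonneg hP l w z))
    ⟨y, Finset.mem_univ y, mul_pos hk hl⟩

theorem exists_pow_pos_of_hasPath (hP : ∀ i j, 0 ≤ P i j) {i j : V}
    (h : HasPath (matrixGraph P) i j) : ∃ k, 0 < (P ^ k) j i := by
  induction h with
  | refl => exact ⟨0, by simp⟩
  | tail _ hadj ih =>
    obtain ⟨k, hk⟩ := ih
    exact ⟨1 + k, pow_add_pos hP (by rwa [pow_one]) hk⟩

theorem pow_pos_of_walk (hP : ∀ i j, 0 ≤ P i j) {l : ℕ} (p : Fin (l + 1) → V)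
    (hp : ∀ t : Fin l, (matrixGraph P).Adj (p t.castSucc) (p t.succ)) :
    0 < (P ^ l) (p (Fin.last l)) (p 0) := by
  induction l with
  | zero => simp
  | succ l ih =>
    have hstep : 0 < (P ^ 1) (p (Fin.last l).succ) (p (Fin.last l).castSucc) := by
      rw [pow_one]
      exact hp (Fin.last l)
    have hwalk := pow_add_pos hP hstep (ih (fun t => p t.castSucc) fun t => hp t.castSucc)
    rwa [add_comm 1 l] at hwalk

/-- The times at which the Markov chain with transition matrix `P` can return to `u`. They form a
submonoid because closed walks can be concatenated. -/
def returnTimes (hP : ∀ i j, 0 ≤ P i j) (u : V) : AddSubmonoid ℕ where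
  carrier := {k | 0 < (P ^ k) u u}
  zero_mem' := by simp
  add_mem' := pow_add_pos hP

/-- A cycle anywhere in the component can be inserted into a closed walk through `u`, so the return
times of `u` have the same greatest common divisor as all cycle lengths. -/
theorem setGcd_returnTimes_eq_one (hP : ∀ i j, 0 ≤ P i j)
    (hS : IsStrongComponent (matrixGraph P) S) (hap : IsAperiodic (matrixGraph P) S) {u : V}
    (hu : u ∈ S) : Nat.setGcd (returnTimes hP u : Set ℕ) = 1 := by
  refine hap _ ?_
  rintro l ⟨p, hpS, hadj, hclosed⟩
  have hl : 0 < (P ^ l) (p 0) (p 0) := by simpa only [← hclosed] using pow_pos_of_walk hP p hadj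
  obtain ⟨a, ha⟩ := exists_pow_pos_of_hasPath hP (hS.hasPath (hpS 0) hu)
  obtain ⟨c, hc⟩ := exists_pow_pos_of_hasPath hP (hS.hasPath hu (hpS 0))
  have hshort : Nat.setGcd (returnTimes hP u : Set ℕ) ∣ a + c :=
    Nat.setGcd_dvd_of_mem (pow_add_pos hP ha hc)
  have hlong : Nat.setGcd (returnTimes hP u : Set ℕ) ∣ l + (a + c) := by
    rw [add_left_comm]
    exact Nat.setGcd_dvd_of_mem (pow_add_pos hP ha (pow_add_pos hP hl hc))
  exact (Nat.dvd_add_left hshort).1 hlong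

theorem exists_forall_ge_pow_pos (hP : ∀ i j, 0 ≤ P i j)
    (hS : IsStrongComponent (matrixGraph P) S) (hap : IsAperiodic (matrixGraph P) S) {u : V}
    (hu : u ∈ S) : ∃ N, ∀ k ≥ N, 0 < (P ^ k) u u := by
  obtain ⟨N, hN⟩ := Nat.exists_mem_closure_of_ge (returnTimes hP u : Set ℕ)
  rw [setGcd_returnTimes_eq_one hP hS hap hu, AddSubmonoid.closure_eq] at hN
  exact ⟨N, fun k hk => hN k hk (one_dvd k)⟩

theorem exists_truncatedHittingTime_recurrentSet_le (hP : P ∈ Matrix.rowStochastic ℝ V) :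
    ∃ B : ℝ≥0, ∀ N i, truncatedHittingTime P (recurrentSet P) N i ≤ B := by
  obtain ⟨B, hB⟩ := exists_truncatedHittingTime_le (T := recurrentSet P) (I := Set.univ) hP
    (fun _ _ _ _ => trivial) fun i _ => by
      obtain ⟨S, hS, j, hj, hji⟩ := exists_isClosedComponent_hasPath (matrixGraph P) i
      obtain ⟨k, hk⟩ := exists_pow_pos_of_hasPath hP.1 hji
      exact ⟨k, j, ⟨S, hS, hj⟩, hk⟩
  exact ⟨B, fun N i => hB N i trivial⟩

theorem exists_truncatedHittingTime_diagonal_le (hP : P ∈ Matrix.rowStochastic ℝ V)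
    (hap : ∀ S, IsClosedComponent (matrixGraph P) S → IsAperiodic (matrixGraph P) S) :
    ∃ B : ℝ≥0, ∀ N, ∀ p ∈ recurrentPairs P,
      truncatedHittingTime (P ⊗ₖ P) (Set.diagonal V) N p ≤ B := by
  refine exists_truncatedHittingTime_le
    (kronecker_mem_rowStochastic hP hP) (isAbsorbing_recurrentPairs hP.1) ?_
  rintro ⟨u, v⟩ ⟨S, hS, hu, hv⟩
  obtain ⟨N, hN⟩ := exists_forall_ge_pow_pos hP.1 hS.1 (hap S hS) hu
  obtain ⟨l, hl⟩ := exists_pow_pos_of_hasPath hP.1 (hS.1.hasPath hu hv)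
  refine ⟨l + N, (u, u), rfl, ?_⟩
  rw [kronecker_pow, Matrix.kronecker_apply]
  exact mul_pos (hN _ (Nat.le_add_left N l)) (pow_add_pos hP.1 hl (hN N le_rfl))

end Reachability

section RandomWalk

variable {V : Type*}

/-- The trajectory that starts at `i` and continues with `X`. -/
def prepend (i : V) (X : ℕ → V) : ℕ → V
  | 0 => i
  | k + 1 => X k

theorem forall_le_prepend_iff {i : V} {X : ℕ → V} {k : ℕ} {p : ℕ → V → Prop} :
    (∀ l ≤ k + 1, p l (prepend i X l)) ↔ p 0 i ∧ ∀ l ≤ k, p (l + 1) (X l) := by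
  simp only [← Nat.lt_succ_iff, Nat.forall_lt_succ_left, prepend]

/-- The first time at which the trajectory `X` is in `T` (`∞` if it never is). -/
noncomputable def hittingTime (T : Set V) (X : ℕ → V) : ℝ≥0∞ :=
  ⨅ (k : ℕ) (_ : X k ∈ T), (k : ℝ≥0∞)

theorem hittingTime_eq_tsum (T : Set V) (X : ℕ → V) :
    hittingTime T X = ∑' k : ℕ, {X : ℕ → V | ∀ l ≤ k, X l ∉ T}.indicator 1 X := by
  classical
  by_cases h : ∃ k, X k ∈ T
  · have hbefore (k : ℕ) : (∀ l ≤ k, X l ∉ T) ↔ k ∈ Finset.range (Nat.find h) := by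
      rw [Finset.mem_range, Nat.lt_find_iff]
    have hfind : hittingTime T X = Nat.find h :=
      le_antisymm (iInf₂_le (Nat.find h) (Nat.find_spec h))
        (le_iInf₂ fun k hk => Nat.cast_le.2 (Nat.find_min' h hk))
    simp only [hfind, Set.indicator_apply, Set.mem_ofPred_eq, hbefore, Pi.one_apply]
    rw [tsum_eq_sum (s := Finset.range (Nat.find h)) (by simp +contextual)]
    simp +contextual
  · push Not at h
    simp [hittingTime, h]

theorem setOf_forall_le_eq (k : ℕ) (p : ℕ → V) :
    {X : ℕ → V | ∀ l ≤ k, X l = p l} =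
      Preorder.frestrictLe (π := fun _ => V) k ⁻¹' {Preorder.frestrictLe k p} := by
  ext X
  simp only [Set.mem_ofPred_eq, Set.mem_preimage, Set.mem_singleton_iff,
    funext_iff, Subtype.forall, Finset.mem_Iic, Preorder.frestrictLe_apply]

section Measurability

variable [MeasurableSpace V]

theorem measurable_prepend (i : V) : Measurable (prepend i) := by
  refine measurable_pi_lambda _ fun k => ?_
  cases k with
  | zero => exact measurable_const
  | succ k => exact measurable_pi_apply k

theorem measurableSet_forall_le {p : ℕ → V → Prop} (hp : ∀ l, MeasurableSet {v | p l v}) (k : ℕ) :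
    MeasurableSet {X : ℕ → V | ∀ l ≤ k, p l (X l)} := by
  simp only [Set.ofPred_forall]
  exact .iInter fun l => .iInter fun _ => measurable_pi_apply (X := fun _ => V) l (hp l)

theorem measurable_hittingTime {T : Set V} (hT : MeasurableSet T) :
    Measurable (hittingTime T) := by
  simp only [funext (hittingTime_eq_tsum T)]
  exact .tsum fun k => measurable_one.indicator (measurableSet_forall_le (fun _ => hT.compl) k)

theorem measure_ext_of_cylinder [Countable V] [MeasurableSingletonClass V]
    {μ ν : Measure (ℕ → V)} [IsFiniteMeasure ν]
    (h : ∀ (k : ℕ) (p : ℕ → V), μ {X | ∀ l ≤ k, X l = p l} = ν {X | ∀ l ≤ k, X l = p l}) :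
    μ = ν := by
  have hfam : IsProjectiveMeasureFamily (α := fun _ : ℕ => V)
      fun I : Finset ℕ => ν.map I.restrict := by
    intro I J hJI
    rw [Measure.map_map (by fun_prop) (by fun_prop)]
    rfl
  have hν : IsProjectiveLimit (α := fun _ : ℕ => V) ν fun I : Finset ℕ => ν.map I.restrict :=
    fun I => rfl
  have hfin : ∀ I : Finset ℕ, IsFiniteMeasure (ν.map (I.restrict (π := fun _ => V))) :=
    fun I => inferInstance
  refine IsProjectiveLimit.unique ((isProjectiveLimit_nat_iff hfam μ).2 fun k => ?_) hν
  change μ.map (Preorder.frestrictLe k) = ν.map (Preorder.frestrictLe k)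
  refine Measure.ext_of_singleton fun y => ?_
  obtain ⟨p, rfl⟩ : ∃ p : ℕ → V, Preorder.frestrictLe k p = y :=
    ⟨fun l => y ⟨min l k, Finset.mem_Iic.2 (min_le_right l k)⟩, by
      ext ⟨l, hl⟩
      simp [min_eq_left (Finset.mem_Iic.1 hl)]⟩
  rw [Measure.map_apply (by fun_prop) (measurableSet_singleton _),
    Measure.map_apply (by fun_prop) (measurableSet_singleton _), ← setOf_forall_le_eq, h]

end Measurability

variable [Fintype V] [DecidableEq V]

theorem sum_ofReal_row_eq_one {P : Matrix V V ℝ} (hP : P ∈ Matrix.rowStochastic ℝ V) (i : V) :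
    ∑ j, ENNReal.ofReal (P i j) = 1 := by
  rw [← ENNReal.ofReal_sum_of_nonneg fun j _ => hP.1 i j,
    Matrix.sum_row_of_mem_rowStochastic hP, ENNReal.ofReal_one]

variable [MeasurableSpace V] [MeasurableSingletonClass V]
  {P : Matrix V V ℝ} (hP : P ∈ Matrix.rowStochastic ℝ V)

theorem stepKernel_singleton (i j : V) : stepKernel P hP i {j} = ENNReal.ofReal (P i j) := by
  change (rowPMF P hP i).toMeasure {j} = _
  rw [PMF.toMeasure_apply_singleton _ _ (measurableSet_singleton j)]
  rfl

theorem map_eval_zero_walkLaw (i : V) : (walkLaw P hP i).map (fun X => X 0) = Measure.dirac i := by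
  have heval : (fun X : ℕ → V => X 0) =
      MeasurableEquiv.piUnique (fun _ : Finset.Iic 0 => V) ∘ Preorder.frestrictLe 0 := rfl
  rw [heval, ← Measure.map_map (by fun_prop) (by fun_prop), walkLaw, Kernel.trajMeasure,
      Measure.map_comp _ _ (by fun_prop), Kernel.traj_map_frestrictLe, Kernel.partialTraj_self,
      Measure.id_comp, Measure.map_map (by fun_prop) (by fun_prop)]
  simp

theorem walkLaw_cylinder_succ (i : V) (p : ℕ → V) (k : ℕ) :
    walkLaw P hP i {X | ∀ l ≤ k + 1, X l = p l} =
      walkLaw P hP i {X | ∀ l ≤ k, X l = p l} * ENNReal.ofReal (P (p k) (p (k + 1))) := by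
  have hlast : {X : ℕ → V | ∀ l ≤ k + 1, X l = p l} =
      (fun X => (Preorder.frestrictLe (π := fun _ => V) k X, X (k + 1))) ⁻¹'
        ({Preorder.frestrictLe k p} ×ˢ {p (k + 1)}) := by
    rw [Set.mk_preimage_prod, ← setOf_forall_le_eq]
    ext X
    simp only [Set.mem_ofPred_eq, Set.mem_inter_iff, Set.mem_preimage, Set.mem_singleton_iff,
      Nat.le_succ_iff, or_imp, forall_and, forall_eq]
  rw [hlast, setOf_forall_le_eq, ← Measure.map_apply (by fun_prop)
    ((measurableSet_singleton _).prod (measurableSet_singleton _)), walkLaw,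
    ← Kernel.map_frestrictLe_trajMeasure_compProd_eq_map_trajMeasure,
    Measure.compProd_apply_prod (measurableSet_singleton _) (measurableSet_singleton _),
    Measure.restrict_singleton, lintegral_smul_measure, lintegral_dirac,
    Measure.map_apply (by fun_prop) (measurableSet_singleton _), smul_eq_mul]
  congr 1
  exact stepKernel_singleton hP _ _

theorem walkLaw_cylinder (i : V) (p : ℕ → V) (k : ℕ) :
    walkLaw P hP i {X | ∀ l ≤ k, X l = p l} =
      (if i = p 0 then 1 else 0) *
        ∏ l ∈ Finset.range k, ENNReal.ofReal (P (p l) (p (l + 1))) := by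
  induction k with
  | zero =>
    have hstart : {X : ℕ → V | ∀ l ≤ 0, X l = p l} = (fun X => X 0) ⁻¹' {p 0} := by ext X; simp
    rw [hstart, ← Measure.map_apply (measurable_pi_apply 0) (measurableSet_singleton _),
      map_eval_zero_walkLaw]
    simp [Set.indicator_apply]
  | succ k ih => rw [walkLaw_cylinder_succ, ih, Finset.prod_range_succ, mul_assoc]

theorem walkLaw_first_step (i : V) :
    walkLaw P hP i = ∑ j, ENNReal.ofReal (P i j) • (walkLaw P hP j).map (prepend i) := by
  refine (measure_ext_of_cylinder fun k p => ?_).symm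
  have hcyl : MeasurableSet {X : ℕ → V | ∀ l ≤ k, X l = p l} :=
    measurableSet_forall_le (fun _ => measurableSet_singleton _) k
  simp only [Measure.finsetSum_apply, Measure.smul_apply, smul_eq_mul,
    Measure.map_apply (measurable_prepend i) hcyl, Set.preimage_ofPred_eq]
  rw [walkLaw_cylinder]
  by_cases hi : i = p 0
  · cases k with
    | zero => simp [← hi, prepend, sum_ofReal_row_eq_one hP]
    | succ k =>
      simp only [forall_le_prepend_iff (p := fun l v => v = p l), hi, true_and]
      simp_rw [walkLaw_cylinder hP _ (fun l => p (l + 1))]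
      simp [Finset.prod_range_succ', mul_comm]
  · have hempty (X : ℕ → V) : ¬ ∀ l ≤ k, prepend i X l = p l := fun h => hi (h 0 k.zero_le)
    simp [hempty, hi]

theorem walkLaw_avoid (T : Set V) (k : ℕ) (i : V) :
    walkLaw P hP i {X | ∀ l ≤ k, X l ∉ T} = ENNReal.ofReal (survival P T k i) := by
  have hfirst (k : ℕ) (i : V) : walkLaw P hP i {X | ∀ l ≤ k, X l ∉ T} =
      ∑ j, ENNReal.ofReal (P i j) * walkLaw P hP j {X | ∀ l ≤ k, prepend i X l ∉ T} := by
    rw [walkLaw_first_step hP i]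
    simp only [Measure.finsetSum_apply, Measure.smul_apply, smul_eq_mul,
      Measure.map_apply (measurable_prepend i)
        (measurableSet_forall_le (fun _ => T.toFinite.measurableSet.compl) k),
      Set.preimage_ofPred_eq]
  induction k generalizing i with
  | zero =>
    rw [hfirst]
    by_cases hi : i ∈ T
    · simp [hi, prepend, survival_of_mem]
    · simp [hi, prepend, survival_zero, sum_ofReal_row_eq_one hP]
  | succ k ih =>
    rw [hfirst]
    simp only [forall_le_prepend_iff (p := fun _ v => v ∉ T)]
    by_cases hi : i ∈ T
    · simp [hi, survival_of_mem]
    · simp only [hi, not_false_eq_true, true_and, ih, survival_succ hi, Matrix.mulVec, dotProduct]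
      rw [ENNReal.ofReal_sum_of_nonneg fun j _ => mul_nonneg (hP.1 i j) (survival_nonneg hP k j)]
      simp only [ENNReal.ofReal_mul (hP.1 i _)]

theorem walkLaw_prod {W : Type*} [Fintype W] [DecidableEq W] [MeasurableSpace W]
    [MeasurableSingletonClass W] {Q : Matrix W W ℝ} (hQ : Q ∈ Matrix.rowStochastic ℝ W)
    (u : V) (v : W) :
    ((walkLaw P hP u).prod (walkLaw Q hQ v)).map (fun ω k => (ω.1 k, ω.2 k)) =
      walkLaw (P ⊗ₖ Q) (kronecker_mem_rowStochastic hP hQ) (u, v) := by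
  refine measure_ext_of_cylinder fun k p => ?_
  have hcyl : MeasurableSet {X : ℕ → V × W | ∀ l ≤ k, X l = p l} :=
    measurableSet_forall_le (p := fun l v => v = p l) (fun _ => measurableSet_singleton _) k
  have hrect : (fun (ω : (ℕ → V) × (ℕ → W)) k => (ω.1 k, ω.2 k)) ⁻¹'
      {X | ∀ l ≤ k, X l = p l} = {X | ∀ l ≤ k, X l = (p l).1} ×ˢ
        {Y | ∀ l ≤ k, Y l = (p l).2} := by
    ext ω
    simp [Prod.ext_iff, forall_and]
  rw [Measure.map_apply (by fun_prop) hcyl, hrect, Measure.prod_prod, walkLaw_cylinder,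
    walkLaw_cylinder, walkLaw_cylinder, mul_mul_mul_comm, ← Finset.prod_mul_distrib]
  simp only [Matrix.kroneckerMap_apply, ENNReal.ofReal_mul (hP.1 _ _), Prod.ext_iff, ite_and,
    ite_mul, one_mul, zero_mul]

theorem lintegral_hittingTime (T : Set V) (i : V) :
    ∫⁻ X, hittingTime T X ∂walkLaw P hP i = ∑' k, ENNReal.ofReal (survival P T k i) := by
  have hmeas (k : ℕ) : MeasurableSet {X : ℕ → V | ∀ l ≤ k, X l ∉ T} :=
    measurableSet_forall_le (fun _ => T.toFinite.measurableSet.compl) k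
  simp only [hittingTime_eq_tsum]
  rw [lintegral_tsum fun k => (measurable_one.indicator (hmeas k)).aemeasurable]
  exact tsum_congr fun k => by rw [lintegral_indicator_one (hmeas k), walkLaw_avoid]

theorem lintegral_hittingTime_le_iff {T : Set V} {i : V} {B : ℝ≥0} :
    ∫⁻ X, hittingTime T X ∂walkLaw P hP i ≤ B ↔ ∀ N, truncatedHittingTime P T N i ≤ B := by
  have hpartial (N : ℕ) : ∑ k ∈ Finset.range N, ENNReal.ofReal (survival P T k i) ≤ B ↔
      truncatedHittingTime P T N i ≤ B := by
    rw [← ENNReal.ofReal_sum_of_nonneg fun k _ => survival_nonneg hP k i, ENNReal.ofReal_le_coe]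
    rfl
  rw [lintegral_hittingTime]
  simp only [← hpartial]
  exact ⟨fun h N => (ENNReal.sum_le_tsum _).trans h, fun h => ENNReal.tsum_le_of_sum_range_le h⟩

theorem lintegral_couplingTime (u v : V) :
    ∫⁻ ω, couplingTime ω.1 ω.2 ∂(walkLaw P hP u).prod (walkLaw P hP v) =
      ∫⁻ X, hittingTime (Set.diagonal V) X
        ∂walkLaw (P ⊗ₖ P) (kronecker_mem_rowStochastic hP hP) (u, v) := by
  rw [← walkLaw_prod, lintegral_map (measurable_hittingTime (Set.toFinite _).measurableSet)
    (by fun_prop)]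
  rfl

theorem maxAbsorptionTime_le_iff {B : ℝ≥0} :
    maxAbsorptionTime P hP ≤ B ↔ ∀ N i, truncatedHittingTime P (recurrentSet P) N i ≤ B := by
  have habs (X : ℕ → V) : absorptionTime (matrixGraph P) X = hittingTime (recurrentSet P) X := rfl
  simp only [maxAbsorptionTime, iSup_le_iff, habs, lintegral_hittingTime_le_iff]
  exact forall_comm

theorem maxCouplingTime_le_iff {B : ℝ≥0} :
    maxCouplingTime P hP ≤ B ↔
      ∀ N, ∀ p ∈ recurrentPairs P, truncatedHittingTime (P ⊗ₖ P) (Set.diagonal V) N p ≤ B := by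
  simp only [maxCouplingTime, iSup_le_iff, lintegral_couplingTime, lintegral_hittingTime_le_iff]
  constructor
  · rintro h N ⟨u, v⟩ ⟨S, hS, hu, hv⟩
    exact h S hS u hu v hv N
  · exact fun h S hS u hu v hv N => h N (u, v) ⟨S, hS, hu, hv⟩

end RandomWalk

section LagCoupling

variable {V : Type*} [Fintype V] [DecidableEq V] {P : Matrix V V ℝ}

open scoped Classical in
/-- The transition matrix of a pair of walks, the second one `n` steps ahead: until the first
walk reaches a closed component, the second one is resampled at every step from the position the
first one will have after `n` more steps; from then on the two walks move independently. -/
noncomputable def lagCoupling (P : Matrix V V ℝ) (n : ℕ) : Matrix (V × V) (V × V) ℝ :=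
  Matrix.of fun p q =>
    P p.1 q.1 * if p.1 ∈ recurrentSet P then P p.2 q.2 else (P ^ n) q.1 q.2

/-- The target set of `lagCoupling`: the two walks meet, and they do so at a recurrent node, since
before that the second walk is resampled at every step. -/
def coupledPairs (P : Matrix V V ℝ) : Set (V × V) :=
  Prod.fst ⁻¹' recurrentSet P ∩ Set.diagonal V

/-- The pairs of positions in which the two walks of `lagCoupling` can be: as soon as the first
one is in a closed component, the second one is in the same component. -/
def laggedPairs (P : Matrix V V ℝ) : Set (V × V) :=
  {p | p.1 ∈ recurrentSet P → p ∈ recurrentPairs P}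

open scoped Classical in
/-- The difference of `f` between the second and the first of the two walks of `lagCoupling P n`,
the second one being averaged out as long as it is resampled. -/
noncomputable def lagGap (P : Matrix V V ℝ) (n : ℕ) (f : V → ℝ) (p : V × V) : ℝ :=
  if p.1 ∈ recurrentSet P then f p.2 - f p.1 else (P ^ n *ᵥ f) p.1 - f p.1

theorem lagCoupling_of_mem (n : ℕ) {p : V × V} (hp : p.1 ∈ recurrentSet P) :
    lagCoupling P n p = (P ⊗ₖ P) p := by
  ext q
  simp only [lagCoupling, Matrix.of_apply, hp, if_true, Matrix.kroneckerMap_apply]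

theorem lagCoupling_mulVec_of_notMem (n : ℕ) {p : V × V} (hp : p.1 ∉ recurrentSet P)
    (f : V × V → ℝ) :
    (lagCoupling P n *ᵥ f) p = (P *ᵥ fun i => (P ^ n *ᵥ fun j => f (i, j)) i) p.1 := by
  simp only [lagCoupling, Matrix.mulVec, dotProduct, Matrix.of_apply, hp, if_false,
    Fintype.sum_prod_type, Finset.mul_sum, mul_assoc]

theorem lagCoupling_mulVec_of_mem (n : ℕ) {p : V × V} (hp : p.1 ∈ recurrentSet P)
    (f : V × V → ℝ) :
    (lagCoupling P n *ᵥ f) p = (P *ᵥ fun i => (P *ᵥ fun j => f (i, j)) p.2) p.1 := by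
  rw [Matrix.mulVec, lagCoupling_of_mem n hp, ← Matrix.mulVec, kronecker_mulVec_apply]

theorem lagCoupling_mulVec_comp_fst (hP : P ∈ Matrix.rowStochastic ℝ V) (n : ℕ) (f : V → ℝ) :
    lagCoupling P n *ᵥ (f ∘ Prod.fst) = (P *ᵥ f) ∘ Prod.fst := by
  ext p
  by_cases hp : p.1 ∈ recurrentSet P
  · rw [lagCoupling_mulVec_of_mem n hp]
    simp only [Function.comp_apply, mulVec_const hP]
  · rw [lagCoupling_mulVec_of_notMem n hp]
    simp only [Function.comp_apply, mulVec_const (pow_mem hP n)]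

theorem lagCoupling_mem_rowStochastic (hP : P ∈ Matrix.rowStochastic ℝ V) (n : ℕ) :
    lagCoupling P n ∈ Matrix.rowStochastic ℝ (V × V) := by
  refine ⟨fun p q => ?_, ?_⟩
  · by_cases hp : p.1 ∈ recurrentSet P
    · rw [lagCoupling_of_mem n hp]
      exact mul_nonneg (hP.1 _ _) (hP.1 _ _)
    · simp only [lagCoupling, Matrix.of_apply, hp, if_false]
      exact mul_nonneg (hP.1 _ _) ((pow_mem hP n).1 _ _)
  · exact (lagCoupling_mulVec_comp_fst hP n 1).trans
      (by rw [Matrix.one_vecMul_of_mem_rowStochastic hP, Pi.one_comp])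

theorem mem_recurrentPairs_of_pow_ne_zero (hP : ∀ i j, 0 ≤ P i j) {n : ℕ} {i j : V}
    (hi : i ∈ recurrentSet P) (hij : (P ^ n) i j ≠ 0) : (i, j) ∈ recurrentPairs P := by
  obtain ⟨S, hS, hiS⟩ := hi
  exact ⟨S, hS, hiS, (hS.isAbsorbing hP).pow n hiS hij⟩

theorem isAbsorbing_lagCoupling_recurrentPairs (hP : ∀ i j, 0 ≤ P i j) (n : ℕ) :
    IsAbsorbing (lagCoupling P n) (recurrentPairs P) := fun _ hp _ hpq =>
  isAbsorbing_recurrentPairs hP hp (lagCoupling_of_mem n (fst_mem_recurrentSet hp) ▸ hpq)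

theorem isAbsorbing_lagCoupling (hP : ∀ i j, 0 ≤ P i j) (n : ℕ) :
    IsAbsorbing (lagCoupling P n) (laggedPairs P) := by
  intro p hp q hpq hq
  by_cases hp₁ : p.1 ∈ recurrentSet P
  · exact isAbsorbing_lagCoupling_recurrentPairs hP n (hp hp₁) hpq
  · simp only [lagCoupling, Matrix.of_apply, hp₁, if_false] at hpq
    exact mem_recurrentPairs_of_pow_ne_zero hP hq (right_ne_zero_of_mul hpq)

theorem survival_lagCoupling_eqOn (hP : ∀ i j, 0 ≤ P i j) (n k : ℕ) :
    Set.EqOn (survival (lagCoupling P n) (coupledPairs P) k)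
      (survival (P ⊗ₖ P) (Set.diagonal V) k) (recurrentPairs P) := by
  refine survival_congr (isAbsorbing_lagCoupling_recurrentPairs hP n)
    (fun p hp => lagCoupling_of_mem n (fst_mem_recurrentSet hp)) ?_ k
  have hsub : recurrentPairs P ⊆ Prod.fst ⁻¹' recurrentSet P := fun p hp => fst_mem_recurrentSet hp
  rw [coupledPairs, ← Set.inter_assoc, Set.inter_eq_left.2 hsub]

theorem truncatedHittingTime_lagCoupling_le (hP : P ∈ Matrix.rowStochastic ℝ V) {L H : ℝ}
    (hL0 : 0 ≤ L)
    (hL : ∀ N, ∀ p ∈ recurrentPairs P, truncatedHittingTime (P ⊗ₖ P) (Set.diagonal V) N p ≤ L)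
    (hH : ∀ N i, truncatedHittingTime P (recurrentSet P) N i ≤ H) (n N : ℕ) :
    ∀ p ∈ laggedPairs P,
      truncatedHittingTime (lagCoupling P n) (coupledPairs P) N p ≤ L + H := by
  intro p hp
  have hcoupled (N : ℕ) (q) (hq : q ∈ laggedPairs P ∩ Prod.fst ⁻¹' recurrentSet P) :
      truncatedHittingTime (lagCoupling P n) (coupledPairs P) N q ≤ L := by
    refine (Finset.sum_congr rfl fun k _ => ?_).trans_le (hL N q (hq.1 hq.2))
    exact survival_lagCoupling_eqOn hP.1 n k (hq.1 hq.2)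
  have habsorbed : truncatedHittingTime (lagCoupling P n) (Prod.fst ⁻¹' recurrentSet P) N p =
      truncatedHittingTime P (recurrentSet P) N p.1 :=
    Finset.sum_congr rfl fun k _ =>
      congrFun (survival_preimage (lagCoupling_mulVec_comp_fst hP n) _ k) p
  calc truncatedHittingTime (lagCoupling P n) _ N p
      ≤ L + truncatedHittingTime (lagCoupling P n) (Prod.fst ⁻¹' recurrentSet P) N p :=
        truncatedHittingTime_le_add (lagCoupling_mem_rowStochastic hP n)
          (isAbsorbing_lagCoupling hP.1 n) hL0 hcoupled N p hp
    _ ≤ L + H := by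
        rw [habsorbed]
        exact add_le_add_right (hH N p.1) L

theorem lagGap_of_mem (n : ℕ) (f : V → ℝ) {p : V × V} (hp : p.1 ∈ recurrentSet P) :
    lagGap P n f p = f p.2 - f p.1 :=
  if_pos hp

theorem lagGap_of_notMem (n : ℕ) (f : V → ℝ) {p : V × V} (hp : p.1 ∉ recurrentSet P) :
    lagGap P n f p = (P ^ n *ᵥ f) p.1 - f p.1 :=
  if_neg hp

theorem pow_mulVec_lagGap (hP : P ∈ Matrix.rowStochastic ℝ V) (n : ℕ) (f : V → ℝ) (i : V) :
    (P ^ n *ᵥ fun j => lagGap P n f (i, j)) i = (P ^ n *ᵥ f) i - f i := by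
  by_cases hi : i ∈ recurrentSet P
  · simp only [lagGap_of_mem n f (p := (i, _)) hi]
    rw [← Pi.sub_def, Matrix.mulVec_sub, mulVec_const (pow_mem hP n), Pi.sub_apply]
  · simp only [lagGap_of_notMem n f (p := (i, _)) hi]
    rw [mulVec_const (pow_mem hP n)]

theorem lagCoupling_mulVec_lagGap (hP : P ∈ Matrix.rowStochastic ℝ V) (n : ℕ) (f : V → ℝ) :
    lagCoupling P n *ᵥ lagGap P n f = lagGap P n (P *ᵥ f) := by
  ext p
  by_cases hp : p.1 ∈ recurrentSet P
  · have hgap : Set.EqOn (fun i => (P *ᵥ fun j => lagGap P n f (i, j)) p.2)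
        (fun i => (P *ᵥ f) p.2 - f i) (recurrentSet P) := by
      intro i hi
      simp only [lagGap_of_mem n f (p := (i, _)) hi]
      rw [← Pi.sub_def, Matrix.mulVec_sub, mulVec_const hP, Pi.sub_apply]
    rw [lagCoupling_mulVec_of_mem n hp, (isAbsorbing_recurrentSet hP.1).mulVec_eqOn hgap hp,
      lagGap_of_mem n _ hp, ← Pi.sub_def, Matrix.mulVec_sub, mulVec_const hP, Pi.sub_apply]
  · rw [lagCoupling_mulVec_of_notMem n hp, lagGap_of_notMem n _ hp]
    simp only [pow_mulVec_lagGap hP]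
    rw [← Pi.sub_def, Matrix.mulVec_sub, Pi.sub_apply, Matrix.mulVec_mulVec, Matrix.mulVec_mulVec,
      pow_mul_comm']

theorem abs_lagGap_le_one (hP : P ∈ Matrix.rowStochastic ℝ V) (n : ℕ) {f : V → ℝ}
    (hf : f ∈ Set.Icc 0 1) (p : V × V) : |lagGap P n f p| ≤ 1 := by
  have hPf := mulVec_mem_Icc (pow_mem hP n) hf
  by_cases hp : p.1 ∈ recurrentSet P
  · rw [lagGap_of_mem n f hp]
    exact abs_sub_le_of_nonneg_of_le (hf.1 _) (hf.2 _) (hf.1 _) (hf.2 _)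
  · rw [lagGap_of_notMem n f hp]
    exact abs_sub_le_of_nonneg_of_le (hPf.1 _) (hPf.2 _) (hf.1 _) (hf.2 _)

theorem abs_pow_add_mulVec_sub_le (hP : P ∈ Matrix.rowStochastic ℝ V) {L H : ℝ} (hL0 : 0 ≤ L)
    (hL : ∀ N, ∀ p ∈ recurrentPairs P, truncatedHittingTime (P ⊗ₖ P) (Set.diagonal V) N p ≤ L)
    (hH : ∀ N i, truncatedHittingTime P (recurrentSet P) N i ≤ H) {f : V → ℝ}
    (hf : f ∈ Set.Icc 0 1) {ε : ℝ} (hε0 : 0 < ε) (hε : ε ≤ 1 / 2) {k : ℕ}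
    (hk : 4 * (L + H) * Real.log (1 / ε) ≤ k) (n : ℕ) (i : V) :
    |(P ^ (k + n) *ᵥ f) i - (P ^ k *ᵥ f) i| ≤ ε := by
  have hM := lagCoupling_mem_rowStochastic hP n
  have hgap (j : V) (hj : (P ^ n) i j ≠ 0) : |lagGap P n (P ^ k *ᵥ f) (i, j)| ≤ ε :=
    calc |lagGap P n (P ^ k *ᵥ f) (i, j)|
        ≤ survival (lagCoupling P n) (coupledPairs P) k (i, j) :=
          abs_le_survival hM (g := fun k => lagGap P n (P ^ k *ᵥ f))
            (fun p => by simpa using abs_lagGap_le_one hP n hf p)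
            (fun k p hp => by rw [lagGap_of_mem n _ hp.1, hp.2, sub_self])
            (fun k => by
              rw [lagCoupling_mulVec_lagGap hP, Matrix.mulVec_mulVec, ← pow_succ']) k (i, j)
      _ ≤ ε := survival_le_of_log_le hM (isAbsorbing_lagCoupling hP.1 n)
          (truncatedHittingTime_lagCoupling_le hP hL0 hL hH n) hε0 hε hk
          fun hi => mem_recurrentPairs_of_pow_ne_zero hP.1 hi hj
  rw [add_comm k, pow_add, ← Matrix.mulVec_mulVec, ← pow_mulVec_lagGap hP]
  calc |(P ^ n *ᵥ fun j => lagGap P n (P ^ k *ᵥ f) (i, j)) i|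
      ≤ ∑ j, (P ^ n) i j * ε := by
        refine (Finset.abs_sum_le_sum_abs _ _).trans (Finset.sum_le_sum fun j _ => ?_)
        rw [abs_mul, abs_of_nonneg ((pow_mem hP n).1 i j)]
        by_cases hj : (P ^ n) i j = 0
        · simp only [hj, zero_mul, le_refl]
        · exact mul_le_mul_of_nonneg_left (hgap j hj) ((pow_mem hP n).1 i j)
    _ = ε := by
        rw [← Finset.sum_mul, Matrix.sum_row_of_mem_rowStochastic (pow_mem hP n), one_mul]

end LagCoupling

section Convergence

theorem exists_tendsto_dist_le {X : Type*} [PseudoMetricSpace X] [CompleteSpace X] {u : ℕ → X}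
    {δ : ℝ} (hδ : 0 < δ) {t : ℝ → ℝ}
    (h : ∀ (ε : ℝ) (k n : ℕ), 0 < ε → ε ≤ δ → t ε ≤ k → dist (u (k + n)) (u k) ≤ ε) :
    ∃ l, Tendsto u atTop (𝓝 l) ∧
      ∀ (ε : ℝ) (k : ℕ), 0 < ε → ε ≤ δ → t ε ≤ k → dist (u k) l ≤ ε := by
  have hcauchy : CauchySeq u := by
    refine Metric.cauchySeq_iff'.2 fun ε hε => ?_
    obtain ⟨k, hk⟩ := exists_nat_ge (t (min (ε / 2) δ))
    refine ⟨k, fun N hN => ?_⟩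
    obtain ⟨n, rfl⟩ := Nat.exists_eq_add_of_le hN
    calc dist (u (k + n)) (u k) ≤ min (ε / 2) δ :=
          h _ k n (lt_min (half_pos hε) hδ) (min_le_right _ _) hk
      _ < ε := (min_le_left _ _).trans_lt (half_lt_self hε)
  obtain ⟨l, hl⟩ := cauchySeq_tendsto_of_complete hcauchy
  refine ⟨l, hl, fun ε k hε0 hε hk => ?_⟩
  have hshift : Tendsto (fun n => u (k + n)) atTop (𝓝 l) := by
    simpa only [add_comm k] using (tendsto_add_atTop_iff_nat k).2 hl
  rw [dist_comm]
  exact le_of_tendsto' (hshift.dist tendsto_const_nhds) fun n => h ε k n hε0 hε hk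

variable {V : Type*} [Fintype V]

theorem sum_vecMul_eq_dotProduct_mulVec (Q : Matrix V V ℝ) (v : V → ℝ) (B : Finset V) :
    ∑ i ∈ B, (v ᵥ* Q) i = v ⬝ᵥ (Q *ᵥ (B : Set V).indicator 1) := by
  classical
  rw [Matrix.dotProduct_mulVec]
  simp [dotProduct, Set.indicator_apply]

theorem abs_dotProduct_le {v : V → ℝ} (hv : v ∈ stdSimplex ℝ V) {f : V → ℝ} {ε : ℝ}
    (hf : ∀ i, |f i| ≤ ε) : |v ⬝ᵥ f| ≤ ε :=
  calc |v ⬝ᵥ f| ≤ ∑ i, v i * ε := by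
        refine (Finset.abs_sum_le_sum_abs _ _).trans (Finset.sum_le_sum fun i _ => ?_)
        rw [abs_mul, abs_of_nonneg (hv.1 i)]
        exact mul_le_mul_of_nonneg_left (hf i) (hv.1 i)
    _ = ε := by rw [← Finset.sum_mul, hv.2, one_mul]

variable [DecidableEq V] {P : Matrix V V ℝ} {L H : ℝ}

theorem exists_tendsto_pow_mulVec (hP : P ∈ Matrix.rowStochastic ℝ V) (hL0 : 0 ≤ L)
    (hL : ∀ N, ∀ p ∈ recurrentPairs P, truncatedHittingTime (P ⊗ₖ P) (Set.diagonal V) N p ≤ L)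
    (hH : ∀ N i, truncatedHittingTime P (recurrentSet P) N i ≤ H) {f : V → ℝ}
    (hf : f ∈ Set.Icc 0 1) :
    ∃ fInf : V → ℝ, Tendsto (fun k : ℕ => P ^ k *ᵥ f) atTop (𝓝 fInf) ∧
      ∀ (ε : ℝ) (k : ℕ), 0 < ε → ε ≤ 1 / 2 → 4 * (L + H) * Real.log (1 / ε) ≤ k →
        dist (P ^ k *ᵥ f) fInf ≤ ε :=
  exists_tendsto_dist_le one_half_pos fun _ _ n hε0 hε hk => (dist_pi_le_iff hε0.le).2 fun i =>
    abs_pow_add_mulVec_sub_le hP hL0 hL hH hf hε0 hε hk n i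

theorem exists_tendsto_vecMul_pow (hP : P ∈ Matrix.rowStochastic ℝ V) (hL0 : 0 ≤ L)
    (hL : ∀ N, ∀ p ∈ recurrentPairs P, truncatedHittingTime (P ⊗ₖ P) (Set.diagonal V) N p ≤ L)
    (hH : ∀ N i, truncatedHittingTime P (recurrentSet P) N i ≤ H) {v : V → ℝ}
    (hv : v ∈ stdSimplex ℝ V) :
    ∃ vInf : V → ℝ, Tendsto (fun k : ℕ => v ᵥ* P ^ k) atTop (𝓝 vInf) ∧
      ∀ (ε : ℝ) (k : ℕ), 0 < ε → ε ≤ 1 / 2 → 4 * (L + H) * Real.log (1 / ε) ≤ k →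
        tvDist (v ᵥ* P ^ k) vInf ≤ ε := by
  have hevent (B : Finset V) (ε : ℝ) (k n : ℕ) (hε0 : 0 < ε) (hε : ε ≤ 1 / 2)
      (hk : 4 * (L + H) * Real.log (1 / ε) ≤ k) :
      |∑ i ∈ B, (v ᵥ* P ^ (k + n)) i - ∑ i ∈ B, (v ᵥ* P ^ k) i| ≤ ε := by
    have hB : (B : Set V).indicator 1 ∈ Set.Icc (0 : V → ℝ) 1 :=
      ⟨Set.indicator_nonneg fun _ _ => zero_le_one, Set.indicator_le_self' fun _ _ => zero_le_one⟩
    rw [sum_vecMul_eq_dotProduct_mulVec, sum_vecMul_eq_dotProduct_mulVec, ← dotProduct_sub]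
    exact abs_dotProduct_le hv fun i => abs_pow_add_mulVec_sub_le hP hL0 hL hH hB hε0 hε hk n i
  obtain ⟨vInf, hlim, -⟩ := exists_tendsto_dist_le (u := fun k => v ᵥ* P ^ k) one_half_pos
    fun ε k n hε0 hε hk => (dist_pi_le_iff hε0.le).2 fun i => by
      simpa only [Finset.sum_singleton, Real.dist_eq] using hevent {i} ε k n hε0 hε hk
  refine ⟨vInf, hlim, fun ε k hε0 hε hk => ciSup_le fun B => ?_⟩
  have hshift : Tendsto (fun n => ∑ i ∈ B, (v ᵥ* P ^ (k + n)) i) atTop (𝓝 (∑ i ∈ B, vInf i)) := by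
    refine tendsto_finsetSum B fun i _ => ?_
    simpa only [add_comm k] using (tendsto_add_atTop_iff_nat k).2 (tendsto_pi_nhds.1 hlim i)
  rw [abs_sub_comm]
  exact le_of_tendsto' (hshift.sub_const _).abs fun n => hevent B ε k n hε0 hε hk

end Convergence

section ExpectedTimes

variable {V : Type*} [Fintype V] [DecidableEq V] [MeasurableSpace V] [MeasurableSingletonClass V]
  {P : Matrix V V ℝ} (hP : P ∈ Matrix.rowStochastic ℝ V)

theorem maxAbsorptionTime_lt_top : maxAbsorptionTime P hP < ⊤ :=
  let ⟨_, hB⟩ := exists_truncatedHittingTime_recurrentSet_le hP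
  ((maxAbsorptionTime_le_iff hP).2 hB).trans_lt ENNReal.coe_lt_top

theorem maxCouplingTime_lt_top
    (hap : ∀ S, IsClosedComponent (matrixGraph P) S → IsAperiodic (matrixGraph P) S) :
    maxCouplingTime P hP < ⊤ :=
  let ⟨_, hB⟩ := exists_truncatedHittingTime_diagonal_le hP hap
  ((maxCouplingTime_le_iff hP).2 hB).trans_lt ENNReal.coe_lt_top

end ExpectedTimes

end BeliefSystem

theorem mainTheorem4_general {V : Type*} [Fintype V] [DecidableEq V] [MeasurableSpace V]
    [MeasurableSingletonClass V] {P : Matrix V V ℝ} (hP : P ∈ Matrix.rowStochastic ℝ V)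
    (hap : ∀ S, IsClosedComponent (matrixGraph P) S → IsAperiodic (matrixGraph P) S) :
    maxCouplingTime P hP < ⊤ ∧ maxAbsorptionTime P hP < ⊤ ∧
    (∀ v ∈ stdSimplex ℝ V, ∃ vInf : V → ℝ,
      Tendsto (fun k : ℕ => v ᵥ* P ^ k) atTop (𝓝 vInf) ∧
      ∀ (ε : ℝ) (k : ℕ), 0 < ε → ε ≤ 1 / 2 →
        4 * ((maxCouplingTime P hP).toReal + (maxAbsorptionTime P hP).toReal) *
          Real.log (1 / ε) ≤ k →
        tvDist (v ᵥ* P ^ k) vInf ≤ ε) ∧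
    (∀ x : ℕ → V → ℝ, (∀ i, x 0 i ∈ Set.Icc (0 : ℝ) 1) →
      (∀ k, x (k + 1) = P *ᵥ x k) → ∃ xInf : V → ℝ,
      Tendsto x atTop (𝓝 xInf) ∧
      ∀ (ε : ℝ) (k : ℕ), 0 < ε → ε ≤ 1 / 2 →
        4 * ((maxCouplingTime P hP).toReal + (maxAbsorptionTime P hP).toReal) *
          Real.log (1 / ε) ≤ k →
        ∀ i, |x k i - xInf i| ≤ ε) := by
  have hL := (maxCouplingTime_le_iff hP (B := (maxCouplingTime P hP).toNNReal)).1
    (ENNReal.coe_toNNReal (maxCouplingTime_lt_top hP hap).ne).ge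
  have hH := (maxAbsorptionTime_le_iff hP (B := (maxAbsorptionTime P hP).toNNReal)).1
    (ENNReal.coe_toNNReal (maxAbsorptionTime_lt_top hP).ne).ge
  refine ⟨maxCouplingTime_lt_top hP hap, maxAbsorptionTime_lt_top hP,
    fun v hv => exists_tendsto_vecMul_pow hP ENNReal.toReal_nonneg hL hH hv, fun x hx hstep => ?_⟩
  obtain ⟨xInf, hlim, hrate⟩ := exists_tendsto_pow_mulVec hP ENNReal.toReal_nonneg hL hH
    (f := x 0) ⟨fun i => (hx i).1, fun i => (hx i).2⟩
  have hpow : (fun k : ℕ => P ^ k *ᵥ x 0) = x := by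
    funext k
    induction k with
    | zero => simp
    | succ k ih => rw [hstep, ← ih, Matrix.mulVec_mulVec, ← pow_succ']
  refine ⟨xInf, hpow ▸ hlim, fun ε k hε0 hε hk i => ?_⟩
  rw [← congrFun hpow k]
  exact (dist_le_pi_dist _ _ i).trans (hrate ε k hε0 hε hk)

theorem mainTheorem4 (n m : ℕ)
    (A : Matrix (Fin n) (Fin n) ℝ) (C : Matrix (Fin m) (Fin m) ℝ) (lam : Fin n → ℝ)
    (hA : A ∈ Matrix.rowStochastic ℝ (Fin n)) (hC : C ∈ Matrix.rowStochastic ℝ (Fin m))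
    (hlam : ∀ i, lam i ∈ Set.Icc (0 : ℝ) 1)
    (hap : ∀ S, IsClosedComponent (matrixGraph (systemMatrix A C lam)) S →
      IsAperiodic (matrixGraph (systemMatrix A C lam)) S) :
    maxCouplingTime (systemMatrix A C lam) (systemMatrix_mem hA hC hlam) < ⊤ ∧
    maxAbsorptionTime (systemMatrix A C lam) (systemMatrix_mem hA hC hlam) < ⊤ ∧
    (∀ v ∈ stdSimplex ℝ (Node n m), ∃ vInf : Node n m → ℝ,
      Tendsto (fun k : ℕ => v ᵥ* systemMatrix A C lam ^ k) atTop (𝓝 vInf) ∧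
      ∀ (ε : ℝ) (k : ℕ), 0 < ε → ε ≤ 1 / 2 →
        4 * ((maxCouplingTime (systemMatrix A C lam) (systemMatrix_mem hA hC hlam)).toReal +
          (maxAbsorptionTime (systemMatrix A C lam) (systemMatrix_mem hA hC hlam)).toReal) *
            Real.log (1 / ε) ≤ k →
        tvDist (v ᵥ* systemMatrix A C lam ^ k) vInf ≤ ε) ∧
    (∀ x : ℕ → Node n m → ℝ, (∀ i, x 0 i ∈ Set.Icc (0 : ℝ) 1) →
      (∀ k, x (k + 1) = systemMatrix A C lam *ᵥ x k) → ∃ xInf : Node n m → ℝ,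
      Tendsto x atTop (𝓝 xInf) ∧
      ∀ (ε : ℝ) (k : ℕ), 0 < ε → ε ≤ 1 / 2 →
        4 * ((maxCouplingTime (systemMatrix A C lam) (systemMatrix_mem hA hC hlam)).toReal +
          (maxAbsorptionTime (systemMatrix A C lam) (systemMatrix_mem hA hC hlam)).toReal) *
            Real.log (1 / ε) ≤ k →
        ∀ i, |x k i - xInf i| ≤ ε) :=
  mainTheorem4_general (systemMatrix_mem hA hC hlam) hap
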